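/- Let $p\in(0,3/4]$ and $q\in(0,1]$. Let $X_1$ be a random variable with $\mathbf P(X_1=1)=q$ and $\mathbf P(X_1=-1)=1-q$, and for $n\ge 2$ let $X_n=\alpha_n X_{\beta_n}$, where $\mathbf P(\alpha_n=1)=p$, $\mathbf P(\alpha_n=-1)=1-p$, where $\beta_n$ is uniformly distributed on $\{1,\dots,n-1\}$, and where $\alpha_n$, $\beta_n$ and the vector $(X_1,\dots,X_{n-1})$ are mutually independent. Let $(Z_n)_{n\ge1}$ be positive i.i.d. random variables, independent of the sequence $(X_n)_{n\ge1}$, with mean $\mathbf E Z_1=1$ and variance $\sigma^2=\mathrm{Var}(Z_1)\ge 0$. The elephant random walk with random step sizes is $S_n=\sum_{i=1}^n Y_i$, where $Y_1=X_1Z_1$ and $Y_n=\alpha_nX_{\beta_n}Z_n$ for $n\ge2$. Put $$a_n=\frac{\Gamma(n)\,\Gamma(2p)}{\Gamma(n+2p-1)}\quad(n\ge1,\text{ so that }a_1=1),\qquad v_n=\sum_{i=1}^n a_i^2 .$$ If $\mathbf E Z_1^2<\infty$, then $$\frac{a_nS_n-(2q-1)}{\sqrt{v_n+n\,a_n^2\,\sigma^2}}$$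 converges in distribution, as $n\to\infty$, to a standard normal random variable. -/

import Mathlib

open MeasureTheory ProbabilityTheory Filter

noncomputable section

namespace ElephantRW

/-- The Rademacher distribution with parameter `r`: mass `r` at `1` and mass `1 - r` at `-1`. -/
def rademacher (r : ℝ) : Measure ℝ :=
  ENNReal.ofReal r • Measure.dirac (1 : ℝ) + ENNReal.ofReal (1 - r) • Measure.dirac (-1 : ℝ)

/-- `X 1, X 2, …` are the steps of an elephant random walk with memory parameter `p` and first-step
parameter `q`, driven by the signs `α 2, α 3, …` and the recalled times `β 2, β 3, …`: the step
at time `n + 1` is `α (n + 1)` times the step at the time `β (n + 1)`, which is drawn uniformly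
from `{1, …, n}`; the sign, the recalled time and the past steps are independent.
The values of `X`, `α`, `β` at the remaining indices play no role. -/
structure IsERW {Ω : Type*} [MeasurableSpace Ω] (μ : Measure Ω) (p q : ℝ)
    (X α : ℕ → Ω → ℝ) (β : ℕ → Ω → ℕ) : Prop where
  measurable_step : ∀ n, 1 ≤ n → Measurable (X n)
  measurable_sign : ∀ n, 2 ≤ n → Measurable (α n)
  measurable_time : ∀ n, 2 ≤ n → Measurable (β n)
  law_first : HasLaw (X 1) (rademacher q) μ
  law_sign : ∀ n, 1 ≤ n → HasLaw (α (n + 1)) (rademacher p) μ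
  law_time : ∀ n, 1 ≤ n → HasLaw (β (n + 1)) (uniformOn (Set.Icc 1 n)) μ
  indep_sign_time : ∀ n, 1 ≤ n → IndepFun (α (n + 1)) (β (n + 1)) μ
  indep_past : ∀ n, 1 ≤ n →
    IndepFun (fun ω ↦ (α (n + 1) ω, β (n + 1) ω)) (fun ω (i : Finset.Icc 1 n) ↦ X i ω) μ
  step_eq : ∀ n, 1 ≤ n → ∀ᵐ ω ∂μ, X (n + 1) ω = α (n + 1) ω * X (β (n + 1) ω) ω

/-- `Z 1, Z 2, …` are positive i.i.d. random step sizes of mean one. -/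
structure IsStepSize {Ω : Type*} [MeasurableSpace Ω] (μ : Measure Ω) (Z : ℕ → Ω → ℝ) : Prop where
  measurable : ∀ n, 1 ≤ n → Measurable (Z n)
  pos : ∀ n, 1 ≤ n → ∀ᵐ ω ∂μ, 0 < Z n ω
  indep : iIndepFun (fun n : ℕ ↦ Z (n + 1)) μ
  identDistrib : ∀ n, 1 ≤ n → IdentDistrib (Z n) (Z 1) μ μ
  integrable : Integrable (Z 1) μ
  mean_one : ∫ ω, Z 1 ω ∂μ = 1

/-- The displacement at time `n`: `Y 1 = X 1 * Z 1` and `Y n = α n * X (β n) * Z n` for `n ≥ 2`. -/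
def displacement {Ω : Type*} (X α : ℕ → Ω → ℝ) (β : ℕ → Ω → ℕ) (Z : ℕ → Ω → ℝ)
    (n : ℕ) (ω : Ω) : ℝ :=
  if n = 1 then X 1 ω * Z 1 ω else α n ω * X (β n ω) ω * Z n ω

/-- The position at time `n` of the elephant random walk with random step sizes. -/
def position {Ω : Type*} (X α : ℕ → Ω → ℝ) (β : ℕ → Ω → ℕ) (Z : ℕ → Ω → ℝ)
    (n : ℕ) (ω : Ω) : ℝ :=
  ∑ i ∈ Finset.Icc 1 n, displacement X α β Z i ω

/-- `a n = Γ(n) Γ(2p) / Γ(n + 2p - 1)` for `n ≥ 1`. -/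
def a (p : ℝ) (n : ℕ) : ℝ :=
  Real.Gamma n * Real.Gamma (2 * p) / Real.Gamma (n + 2 * p - 1)

theorem a_one {p : ℝ} (hp : 0 < p) : a p 1 = 1 := by
  have h : Real.Gamma (2 * p) ≠ 0 := (Real.Gamma_pos_of_pos (by linarith)).ne'
  simp [a, h]

/-- `v n = a 1 ^ 2 + ⋯ + a n ^ 2`. -/
def v (p : ℝ) (n : ℕ) : ℝ :=
  ∑ i ∈ Finset.Icc 1 n, a p i ^ 2

end ElephantRW

end

/-! ### Growth of the coefficients `a p n` and of `v p n`. -/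

namespace ElephantRW

open Finset Topology

/-! The proof works with characteristic functions directly, without a martingale limit theorem. Let
T_n be the walk with unit steps. Averaging over the sign and the recalled time
(`integral_step_smul`) replaces X_{n+1} by (2p-1) T_n / n. Since X_{n+1} = ±1, this turns E exp(iθ
T_{n+1}) into the mean of (cos θ + i (2p-1)(T_n/n) sin θ) exp(iθ T_n). The bracket is close to
exp(-θ²/2) exp(iθ (2p-1) T_n/n), with an error controlled by θ² E(T_n/n)² + |θ|³.

For θ = c a_{n+1} the new frequency is c a_n, because a_{n+1}(1 + (2p-1)/n) = a_n. The recursion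
therefore telescopes: E exp(i c a_n T_n) is close to exp(-c² v_n / 2) (`norm_charFun_sub_exp_le`).
When c² v_n stays bounded, the accumulated errors are averages with weights a_i² of E(T_i/i)² and of
a_i/√v_i. Both of these tend to 0, and v_n → ∞ because p ≤ 3/4, so the errors vanish
(`tendsto_charFun_sub_exp`).

Random step sizes enter by conditioning on X. The characteristic function of Z_1 at ±d is exp(±id)
exp(-σ²d²/2) up to o(d²), and the Gaussian factor does not depend on the sign. So they contribute
the deterministic factor exp(-n σ² d²/2), up to n o(d²) (`norm_charFun_position_sub_le`). With d = c
a_n, the quantity n d² is bounded, and the two Gaussian factors combine to exp(-t²/2). -/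

theorem a_pos {p : ℝ} (hp : 0 < p) {n : ℕ} (hn : 1 ≤ n) : 0 < a p n := by
  have hn' : (1 : ℝ) ≤ n := by exact_mod_cast hn
  exact div_pos (mul_pos (Real.Gamma_pos_of_pos (by linarith)) (Real.Gamma_pos_of_pos (by linarith)))
    (Real.Gamma_pos_of_pos (by linarith))

theorem a_succ {p : ℝ} (hp : 0 < p) {n : ℕ} (hn : 1 ≤ n) :
    a p (n + 1) * (n + (2 * p - 1)) = n * a p n := by
  have hn' : (1 : ℝ) ≤ n := by exact_mod_cast hn
  have h1 : Real.Gamma ((n + 1 : ℕ) : ℝ) = n * Real.Gamma n := by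
    push_cast; exact Real.Gamma_add_one (by linarith)
  have hpos : 0 < (n : ℝ) + 2 * p - 1 := by linarith
  have h2 : Real.Gamma (((n + 1 : ℕ) : ℝ) + 2 * p - 1)
      = (n + 2 * p - 1) * Real.Gamma (n + 2 * p - 1) := by
    rw [← Real.Gamma_add_one hpos.ne']; push_cast; ring_nf
  have h3 := (Real.Gamma_pos_of_pos hpos).ne'
  rw [a, a, h1, h2]
  have := hpos.ne'
  field_simp
  ring

/-- The form in which the characteristic function recursion uses the coefficients: one step back in
time turns the frequency c a_{n+1} into c a_n. -/
theorem a_eq_succ_mul {p : ℝ} (hp : 0 < p) {n : ℕ} (hn : 1 ≤ n) :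
    a p n = a p (n + 1) * (1 + (2 * p - 1) / n) := by
  have hn' : (n : ℝ) ≠ 0 := by positivity
  have := a_succ hp hn
  field_simp
  linarith

theorem v_succ (p : ℝ) (n : ℕ) : v p (n + 1) = v p n + a p (n + 1) ^ 2 := by
  rw [v, v, Finset.sum_Icc_succ_top (by omega)]

theorem v_nonneg (p : ℝ) (n : ℕ) : 0 ≤ v p n := Finset.sum_nonneg fun _ _ ↦ sq_nonneg _

theorem natCast_mul_a_sq_le {p : ℝ} (hp : 0 < p) {n : ℕ} (hn : 1 ≤ n) :
    n * a p n ^ 2 ≤ 3 * v p n := by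
  induction n, hn using Nat.le_induction with
  | base => simp [v]; nlinarith [sq_nonneg (a p 1)]
  | succ n hn ih =>
    have hn' : (1 : ℝ) ≤ n := by exact_mod_cast hn
    rw [v_succ]
    rw [a_eq_succ_mul hp hn] at ih
    have h0 := v_nonneg p n
    push_cast
    set b := a p (n + 1)
    -- Uses only 2p - 1 ≥ -1. The constant 3 closes the induction because n + 1 = (n - 2) + 3.
    have key : (n : ℝ) - 2 ≤ n * (1 + (2 * p - 1) / n) ^ 2 := by
      have : (n : ℝ) * (1 + (2 * p - 1) / n) ^ 2 = n + 2 * (2 * p - 1) + (2 * p - 1) ^ 2 / n := by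
        field_simp; ring
      rw [this]
      have : 0 ≤ (2 * p - 1) ^ 2 / n := by positivity
      linarith
    nlinarith [mul_le_mul_of_nonneg_right key (sq_nonneg b)]

theorem le_natCast_mul_a_sq {p : ℝ} (hp : 0 < p) (hp' : p ≤ 3 / 4) {n : ℕ} (hn : 1 ≤ n) :
    3 / 4 ≤ n * a p n ^ 2 := by
  -- The sequence (n - 1/4) a_n² is nondecreasing and equals 3/4 at n = 1. The shift 1/4 cancels the
  -- 1/n term of (n - 1/4)(1 + 1/(2n))², the critical case p = 3/4.
  suffices h : 3 / 4 ≤ (n - 1 / 4 : ℝ) * a p n ^ 2 by nlinarith [sq_nonneg (a p n)]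
  induction n, hn using Nat.le_induction with
  | base => rw [a_one hp]; norm_num
  | succ n hn ih =>
    have hn' : (1 : ℝ) ≤ n := by exact_mod_cast hn
    refine ih.trans ?_
    rw [a_eq_succ_mul hp hn]
    suffices h : ((n : ℝ) - 1 / 4) * (1 + (2 * p - 1) / n) ^ 2 ≤ ((n + 1 : ℕ) : ℝ) - 1 / 4 by
      refine le_trans (le_of_eq ?_) (mul_le_mul_of_nonneg_right h (sq_nonneg (a p (n + 1))))
      ring
    have h1 : (1 + (2 * p - 1) / n) ^ 2 ≤ (1 + 1 / 2 / (n : ℝ)) ^ 2 := by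
      have : 0 ≤ 1 + (2 * p - 1) / (n : ℝ) := by
        have : 1 + (2 * p - 1) / (n : ℝ) = (n - 1 + 2 * p) / n := by field_simp; ring
        rw [this]; apply div_nonneg <;> linarith
      gcongr; linarith
    refine (mul_le_mul_of_nonneg_left h1 (by linarith)).trans ?_
    have : ((n : ℝ) - 1 / 4) * (1 + 1 / 2 / (n : ℝ)) ^ 2 = n + 3 / 4 - 1 / (16 * n ^ 2) := by
      field_simp; ring
    rw [this]
    have : 0 ≤ 1 / (16 * (n : ℝ) ^ 2) := by positivity
    push_cast; linarith

theorem v_eq_sum_range (p : ℝ) (n : ℕ) : v p n = ∑ i ∈ range n, a p (i + 1) ^ 2 := by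
  rw [v, Finset.range_eq_Ico, Finset.sum_Ico_add' (fun i ↦ a p i ^ 2) 0 n 1]
  rfl

theorem tendsto_v_atTop {p : ℝ} (hp : 0 < p) (hp' : p ≤ 3 / 4) : Tendsto (v p) atTop atTop := by
  have h : Tendsto (fun n : ℕ ↦ 3 / 4 * ∑ i ∈ range n, (1 / (i + 1) : ℝ)) atTop atTop :=
    Real.tendsto_sum_range_one_div_nat_succ_atTop.const_mul_atTop (by norm_num)
  refine tendsto_atTop_mono (fun n ↦ ?_) h
  rw [v_eq_sum_range, Finset.mul_sum]
  refine Finset.sum_le_sum fun i _ ↦ ?_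
  have := le_natCast_mul_a_sq hp hp' (n := i + 1) (by omega)
  push_cast at this
  rw [mul_one_div, div_le_iff₀ (by positivity)]
  linarith

theorem v_pos {p : ℝ} (hp : 0 < p) {n : ℕ} (hn : 1 ≤ n) : 0 < v p n :=
  Finset.sum_pos (fun _ hi ↦ pow_pos (a_pos hp (Finset.mem_Icc.1 hi).1) 2) ⟨1, by simp [hn]⟩

/-- Cesàro's argument with weights a_i², whose total mass v_n diverges. -/
theorem tendsto_weighted_average_zero {p : ℝ} (hp : 0 < p) (hp' : p ≤ 3 / 4) {f : ℕ → ℝ}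
    (hf : Tendsto f atTop (𝓝 0)) :
    Tendsto (fun n ↦ (∑ i ∈ range n, a p (i + 1) ^ 2 * f i) / v p n) atTop (𝓝 0) := by
  have h1 : (fun i ↦ a p (i + 1) ^ 2 * f i) =o[atTop] fun i ↦ a p (i + 1) ^ 2 := by
    simpa using (Asymptotics.isBigO_refl (fun i ↦ a p (i + 1) ^ 2) atTop).mul_isLittleO
      ((Asymptotics.isLittleO_one_iff ℝ).2 hf)
  have hv : Tendsto (fun n ↦ ∑ i ∈ range n, a p (i + 1) ^ 2) atTop atTop := by
    simpa only [← v_eq_sum_range] using tendsto_v_atTop hp hp'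
  have := (h1.sum_range (fun _ ↦ sq_nonneg _) hv).tendsto_div_nhds_zero
  simpa only [← v_eq_sum_range] using this

theorem tendsto_a_div_sqrt_v {p : ℝ} (hp : 0 < p) :
    Tendsto (fun n ↦ a p (n + 1) / √(v p (n + 1))) atTop (𝓝 0) := by
  have h : Tendsto (fun n : ℕ ↦ √(3 / ((n : ℝ) + 1))) atTop (𝓝 0) := by
    rw [← Real.sqrt_zero]
    refine (Real.continuous_sqrt.tendsto 0).comp ?_
    exact tendsto_const_nhds.div_atTop (tendsto_natCast_atTop_atTop.atTop_add tendsto_const_nhds)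
  refine squeeze_zero (fun n ↦ div_nonneg (a_pos hp (by omega)).le (Real.sqrt_nonneg _))
    (fun n ↦ Real.le_sqrt_of_sq_le ?_) h
  have h1 := natCast_mul_a_sq_le hp (n := n + 1) (by omega)
  have h2 := v_pos hp (n := n + 1) (by omega)
  push_cast at h1
  rw [div_pow, Real.sq_sqrt h2.le, div_le_div_iff₀ h2 (by positivity)]
  linarith

end ElephantRW

/-! ### The walk with unit steps: averaging over one step. -/

namespace ElephantRW

open Finset Topology

variable {Ω : Type*} [MeasurableSpace Ω] {μ : Measure Ω}
    {p q : ℝ} {X α : ℕ → Ω → ℝ} {β : ℕ → Ω → ℕ}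

/-- The position at time `n` of the elephant random walk with unit steps. -/
def unitPosition {Ω : Type*} (X : ℕ → Ω → ℝ) (n : ℕ) (ω : Ω) : ℝ := ∑ i ∈ Icc 1 n, X i ω

theorem unitPosition_succ {Ω : Type*} (X : ℕ → Ω → ℝ) (n : ℕ) (ω : Ω) :
    unitPosition X (n + 1) ω = unitPosition X n ω + X (n + 1) ω := by
  rw [unitPosition, unitPosition, Finset.sum_Icc_succ_top (by omega)]

theorem ae_rademacher (r : ℝ) : ∀ᵐ x ∂rademacher r, x = 1 ∨ x = -1 := by
  have hm : MeasurableSet {x : ℝ | x = 1 ∨ x = -1} :=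
    (measurableSet_singleton 1).union (measurableSet_singleton (-1))
  rw [rademacher, ae_add_measure_iff]
  exact ⟨Measure.ae_smul_measure ((ae_dirac_iff hm).2 (by simp)) _,
    Measure.ae_smul_measure ((ae_dirac_iff hm).2 (by simp)) _⟩

theorem integral_rademacher {r : ℝ} (hr : 0 ≤ r) (hr' : r ≤ 1) :
    ∫ x, x ∂rademacher r = 2 * r - 1 := by
  have h (c x : ℝ) : Integrable (fun y : ℝ ↦ y) (ENNReal.ofReal c • Measure.dirac x) :=
    (integrable_dirac (by simp)).smul_measure ENNReal.ofReal_ne_top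
  rw [rademacher, integral_add_measure (h _ _) (h _ _), integral_smul_measure,
    integral_smul_measure, integral_dirac, integral_dirac, ENNReal.toReal_ofReal hr,
    ENNReal.toReal_ofReal (by linarith)]
  simp; ring

namespace IsERW

theorem ae_time_mem (h : IsERW μ p q X α β) {n : ℕ} (hn : 1 ≤ n) :
    ∀ᵐ ω ∂μ, β (n + 1) ω ∈ Icc 1 n := by
  have := (h.law_time n hn).ae_iff (p := fun k ↦ k ∈ Icc 1 n) (measurable_of_countable _)
  rw [this]
  filter_upwards [ae_cond_mem (μ := Measure.count) (s := Set.Icc 1 n) measurableSet_Icc] with k hk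
  simpa using hk

theorem ae_sign (h : IsERW μ p q X α β) {n : ℕ} (hn : 1 ≤ n) :
    ∀ᵐ ω ∂μ, α (n + 1) ω = 1 ∨ α (n + 1) ω = -1 := by
  have hm : MeasurableSet {x : ℝ | x = 1 ∨ x = -1} :=
    (measurableSet_singleton 1).union (measurableSet_singleton (-1))
  exact ((h.law_sign n hn).ae_iff (measurableSet_setOfPred.1 hm)).2 (ae_rademacher p)

theorem ae_step (h : IsERW μ p q X α β) {n : ℕ} (hn : 1 ≤ n) :
    ∀ᵐ ω ∂μ, X n ω = 1 ∨ X n ω = -1 := by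
  have hm : MeasurableSet {x : ℝ | x = 1 ∨ x = -1} :=
    (measurableSet_singleton 1).union (measurableSet_singleton (-1))
  induction n using Nat.strong_induction_on with
  | _ n ih =>
    obtain rfl | hn1 := hn.eq_or_lt
    · exact (h.law_first.ae_iff (measurableSet_setOfPred.1 hm)).2 (ae_rademacher q)
    · obtain ⟨m, rfl⟩ : ∃ m, n = m + 1 := ⟨n - 1, by omega⟩
      have hall : ∀ᵐ ω ∂μ, ∀ k : ℕ, 1 ≤ k → k < m + 1 → (X k ω = 1 ∨ X k ω = -1) := by
        refine ae_all_iff.2 fun k ↦ ?_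
        by_cases hk : 1 ≤ k ∧ k < m + 1
        · filter_upwards [ih k hk.2 hk.1] with ω hω _ _ using hω
        · exact .of_forall fun ω h1 h2 ↦ absurd ⟨h1, h2⟩ hk
      have hm1 : 1 ≤ m := by omega
      filter_upwards [hall, h.ae_sign hm1, h.ae_time_mem hm1, h.step_eq m hm1] with ω h1 h2 h3 h4
      rw [Finset.mem_Icc] at h3
      rw [h4]
      rcases h2 with h2 | h2 <;> rcases h1 _ h3.1 (by omega) with h5 | h5 <;> simp [h2, h5]

theorem ae_norm_step_le (h : IsERW μ p q X α β) {n : ℕ} (hn : 1 ≤ n) :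
    ∀ᵐ ω ∂μ, ‖X n ω‖ ≤ 1 := by
  filter_upwards [h.ae_step hn] with ω hω
  rcases hω with hω | hω <;> simp [hω]

theorem integral_sign_mul_indicator (h : IsERW μ p q X α β) (hp : 0 ≤ p) (hp' : p ≤ 1)
    {n k : ℕ} (hn : 1 ≤ n) (hk : k ∈ Icc 1 n) :
    ∫ ω, α (n + 1) ω * (if β (n + 1) ω = k then 1 else 0) ∂μ = (2 * p - 1) / n := by
  have hβ := h.measurable_time (n + 1) (by omega)
  have hα := h.measurable_sign (n + 1) (by omega)
  have hf : Measurable fun j : ℕ ↦ if j = k then (1 : ℝ) else 0 := measurable_of_countable _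
  have h1 := ((h.indep_sign_time n hn).comp measurable_id hf).integral_fun_mul_eq_mul_integral
    hα.aestronglyMeasurable (hf.comp hβ).aestronglyMeasurable
  simp only [Function.comp_def, id] at h1
  rw [h1, (h.law_sign n hn).integral_eq, integral_rademacher hp hp']
  have h2 := (h.law_time n hn).integral_comp (f := fun j : ℕ ↦ if j = k then (1 : ℝ) else 0)
    hf.aestronglyMeasurable
  simp only [Function.comp_def] at h2
  have h3 : (fun j : ℕ ↦ if j = k then (1 : ℝ) else 0) = Set.indicator {k} 1 := by
    ext j; simp [Set.indicator_apply]
  rw [h2, h3, integral_indicator_one (measurableSet_singleton k), Measure.real,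
    ← Finset.coe_Icc, ← Finset.coe_singleton, uniformOn_apply_finset,
    Finset.inter_singleton_of_mem hk]
  simp [div_eq_mul_inv]

theorem measurable_unitPosition (h : IsERW μ p q X α β) (n : ℕ) : Measurable (unitPosition X n) :=
  Finset.measurable_sum _ fun i hi ↦ h.measurable_step i (Finset.mem_Icc.1 hi).1

/-- Averaging over the sign and the recalled time of step `n + 1`. -/
theorem integral_step_smul {E : Type*} [NormedAddCommGroup E] [NormedSpace ℝ E]
    [MeasurableSpace E] [BorelSpace E] [SecondCountableTopology E]
    (h : IsERW μ p q X α β) (hp : 0 ≤ p) (hp' : p ≤ 1) {n : ℕ} (hn : 1 ≤ n)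
    {g : (Icc 1 n → ℝ) → E} (hg : Measurable g)
    (hgi : Integrable (fun ω ↦ g fun i ↦ X i ω) μ) :
    ∫ ω, X (n + 1) ω • g (fun i ↦ X i ω) ∂μ
      = ((2 * p - 1) / n) • ∫ ω, unitPosition X n ω • g (fun i ↦ X i ω) ∂μ := by
  have hβ := h.measurable_time (n + 1) (by omega)
  have hα := h.measurable_sign (n + 1) (by omega)
  have hf (k : ℕ) : Measurable fun j : ℝ × ℕ ↦ j.1 * if j.2 = k then (1 : ℝ) else 0 :=
    measurable_fst.mul ((measurable_of_countable fun j : ℕ ↦ if j = k then (1 : ℝ) else 0).comp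
      measurable_snd)
  have hX (k : Icc 1 n) : Measurable (X k) := h.measurable_step k (Finset.mem_Icc.1 k.2).1
  have hpast : Measurable fun ω (i : Icc 1 n) ↦ X i ω := measurable_pi_lambda _ hX
  have hXi (k : ℕ) (hk : k ∈ Icc 1 n) : Integrable (fun ω ↦ X k ω • g fun i ↦ X i ω) μ :=
    hgi.bdd_smul 1 (hX ⟨k, hk⟩).aestronglyMeasurable (h.ae_norm_step_le (Finset.mem_Icc.1 hk).1)
  have hcoef (k : ℕ) : Measurable fun ω ↦ α (n + 1) ω * if β (n + 1) ω = k then (1 : ℝ) else 0 :=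
    (hf k).comp (hα.prodMk hβ)
  have hterm (k : ℕ) (hk : k ∈ Icc 1 n) :
      ∫ ω, (α (n + 1) ω * if β (n + 1) ω = k then (1 : ℝ) else 0) • X k ω • g (fun i ↦ X i ω) ∂μ
        = ((2 * p - 1) / n) • ∫ ω, X k ω • g (fun i ↦ X i ω) ∂μ := by
    have hg' : Measurable fun x : Icc 1 n → ℝ ↦ x ⟨k, hk⟩ • g x :=
      (measurable_pi_apply _).smul hg
    have := ((h.indep_past n hn).comp (hf k) hg').integral_fun_smul_eq_smul_integral (𝕜 := ℝ)
      (hcoef k).aestronglyMeasurable (hg'.comp hpast).aestronglyMeasurable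
    simp only [Function.comp_def] at this
    rw [this, h.integral_sign_mul_indicator hp hp' hn hk]
  -- Splitting according to the recalled time k makes each term a product of a function of (α, β)
  -- and a function of the past, so independence applies term by term.
  have hae : (fun ω ↦ X (n + 1) ω • g (fun i ↦ X i ω)) =ᵐ[μ] fun ω ↦ ∑ k ∈ Icc 1 n,
      (α (n + 1) ω * if β (n + 1) ω = k then (1 : ℝ) else 0) • X k ω • g (fun i ↦ X i ω) := by
    filter_upwards [h.step_eq n hn, h.ae_time_mem hn] with ω h1 h2
    rw [Finset.sum_eq_single_of_mem _ h2 (fun k _ hk ↦ by simp [hk.symm]), h1]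
    simp [mul_smul]
  rw [integral_congr_ae hae, integral_finsetSum _ fun k hk ↦ ?_, Finset.sum_congr rfl hterm,
    ← Finset.smul_sum, ← integral_finsetSum _ hXi]
  · simp [unitPosition, Finset.sum_smul]
  · refine (hXi k hk).bdd_smul 1 (hcoef k).aestronglyMeasurable ?_
    filter_upwards [h.ae_sign hn] with ω hω
    rcases hω with hω | hω <;> rw [hω] <;> split_ifs <;> simp

theorem ae_abs_unitPosition_le (h : IsERW μ p q X α β) (n : ℕ) :
    ∀ᵐ ω ∂μ, |unitPosition X n ω| ≤ n := by
  have : ∀ᵐ ω ∂μ, ∀ i ∈ Icc 1 n, ‖X i ω‖ ≤ 1 :=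
    (ae_ball_iff (Finset.countable_toSet _)).2 fun i hi ↦
      h.ae_norm_step_le (Finset.mem_Icc.1 hi).1
  filter_upwards [this] with ω hω
  simpa [unitPosition] using norm_sum_le_of_le _ hω

/-! ### Second moment of the walk with unit steps. -/

variable [IsProbabilityMeasure μ]

theorem integrable_unitPosition_sq (h : IsERW μ p q X α β) (n : ℕ) :
    Integrable (fun ω ↦ unitPosition X n ω ^ 2) μ := by
  refine .of_bound ((h.measurable_unitPosition n).pow_const 2).aestronglyMeasurable ((n : ℝ) ^ 2) ?_
  filter_upwards [h.ae_abs_unitPosition_le n] with ω hω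
  rw [norm_pow]
  exact pow_le_pow_left₀ (norm_nonneg _) hω 2

theorem integral_unitPosition_sq_succ (h : IsERW μ p q X α β) (hp : 0 ≤ p) (hp' : p ≤ 1) {n : ℕ}
    (hn : 1 ≤ n) : ∫ ω, unitPosition X (n + 1) ω ^ 2 ∂μ
      = (1 + 2 * (2 * p - 1) / n) * ∫ ω, unitPosition X n ω ^ 2 ∂μ + 1 := by
  have hT := h.measurable_unitPosition n
  have hi := h.integrable_unitPosition_sq n
  have hTi : Integrable (unitPosition X n) μ :=
    .of_bound hT.aestronglyMeasurable (n : ℝ) (h.ae_abs_unitPosition_le n)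
  have hg : Measurable fun x : Icc 1 n → ℝ ↦ ∑ i, x i := by fun_prop
  have hgT (ω : Ω) : ∑ i : Icc 1 n, X i ω = unitPosition X n ω :=
    Finset.sum_coe_sort (Icc 1 n) fun i ↦ X i ω
  have key := h.integral_step_smul hp hp' hn hg (by simpa only [hgT] using hTi)
  simp only [hgT, smul_eq_mul] at key
  have hXTi : Integrable (fun ω ↦ X (n + 1) ω * unitPosition X n ω) μ :=
    hTi.bdd_mul (h.measurable_step (n + 1) (by omega)).aestronglyMeasurable
      (h.ae_norm_step_le (by omega))
  have hae : (fun ω ↦ unitPosition X (n + 1) ω ^ 2) =ᵐ[μ]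
      fun ω ↦ (unitPosition X n ω ^ 2 + 2 * (X (n + 1) ω * unitPosition X n ω)) + 1 := by
    filter_upwards [h.ae_step (n := n + 1) (by omega)] with ω hω
    rw [unitPosition_succ]
    rcases hω with hω | hω <;> rw [hω] <;> ring
  have hs : Integrable (fun ω ↦ unitPosition X n ω ^ 2 + 2 * (X (n + 1) ω * unitPosition X n ω)) μ :=
    hi.add (hXTi.const_mul 2)
  rw [integral_congr_ae hae, integral_add hs (integrable_const _),
    integral_add hi (hXTi.const_mul 2), integral_const_mul, key]
  simp only [← sq, integral_const, probReal_univ, smul_eq_mul]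
  ring

/-- For p ≤ 3/4 one has 2(2p-1) ≤ 1, so the second moments are dominated by the solution of u_{n+1}
= (1 + 1/n) u_n + 1 with u_1 = 1, which is n times the n-th harmonic number. -/
theorem integral_unitPosition_sq_le (h : IsERW μ p q X α β) (hp : 0 ≤ p) (hp' : p ≤ 3 / 4)
    (n : ℕ) : ∫ ω, unitPosition X (n + 1) ω ^ 2 ∂μ
      ≤ (n + 1) * ∑ i ∈ range (n + 1), (1 / ((i : ℝ) + 1)) := by
  induction n with
  | zero =>
    have : (fun ω ↦ unitPosition X (0 + 1) ω ^ 2) =ᵐ[μ] fun _ ↦ 1 := by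
      filter_upwards [h.ae_step le_rfl] with ω hω
      rcases hω with hω | hω <;> simp [unitPosition, hω]
    rw [integral_congr_ae this]
    simp
  | succ n ih =>
    rw [h.integral_unitPosition_sq_succ hp (by linarith) (by omega), Finset.sum_range_succ _ (n + 1)]
    have h0 : 0 ≤ ∫ ω, unitPosition X (n + 1) ω ^ 2 ∂μ := integral_nonneg fun _ ↦ sq_nonneg _
    set H := ∑ i ∈ range (n + 1), (1 / ((i : ℝ) + 1))
    push_cast
    have h1 : 1 + 2 * (2 * p - 1) / ((n : ℝ) + 1) ≤ 1 + 1 / ((n : ℝ) + 1) := by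
      gcongr; linarith
    have h2 := mul_le_mul_of_nonneg_right h1 h0
    have h3 := mul_le_mul_of_nonneg_left ih (a := 1 + 1 / ((n : ℝ) + 1)) (by positivity)
    have h4 : (1 + 1 / ((n : ℝ) + 1)) * ((n + 1) * H) + 1
        = (n + 1 + 1) * (H + 1 / (n + 1 + 1)) := by field_simp
    linarith

theorem tendsto_integral_unitPosition_div_sq (h : IsERW μ p q X α β) (hp : 0 ≤ p)
    (hp' : p ≤ 3 / 4) :
    Tendsto (fun n : ℕ ↦ ∫ ω, (unitPosition X n ω / n) ^ 2 ∂μ) atTop (𝓝 0) := by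
  have h1 : Tendsto (fun n : ℕ ↦ (n : ℝ)⁻¹ * ∑ i ∈ range n, (1 / ((i : ℝ) + 1))) atTop (𝓝 0) :=
    tendsto_one_div_add_atTop_nhds_zero_nat.cesaro
  refine squeeze_zero' (.of_forall fun n ↦ integral_nonneg fun _ ↦ sq_nonneg _) ?_ h1
  filter_upwards [eventually_ge_atTop 1] with n hn
  obtain ⟨m, rfl⟩ : ∃ m, n = m + 1 := ⟨n - 1, by omega⟩
  have h2 := h.integral_unitPosition_sq_le hp hp' m
  simp only [div_pow]
  rw [integral_div, div_le_iff₀ (by positivity)]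
  refine h2.trans (le_of_eq ?_)
  push_cast
  field_simp

end IsERW

end ElephantRW

/-! ### Characteristic function of the walk with unit steps. -/

namespace ElephantRW

open Finset Topology Complex

/-- For |θ| ≤ 1, both cos θ - exp(-θ²/2) and sin θ - θ exp(-θ²/2) are of third order. The only
second-order error is that of exp(iθy) - 1 - iθy, and it carries the factor y², which will be small
in mean. For |θ| > 1 the trivial bound 3 suffices. -/
theorem norm_cos_add_sin_sub_exp_le {θ y : ℝ} (hy : |y| ≤ 1) :
    ‖(Real.cos θ + y * Real.sin θ * I : ℂ) - Real.exp (-θ ^ 2 / 2) * exp ((θ * y : ℝ) * I)‖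
      ≤ θ ^ 2 * y ^ 2 + 4 * |θ| ^ 3 := by
  set e := Real.exp (-θ ^ 2 / 2)
  have he0 : 0 < e := Real.exp_pos _
  have he1 : e ≤ 1 := Real.exp_le_one_iff.2 (by nlinarith [sq_nonneg θ])
  have hexp : ‖exp ((θ * y : ℝ) * I)‖ = 1 := norm_exp_ofReal_mul_I _
  rcases le_or_gt |θ| 1 with hθ | hθ
  · have hsq : θ ^ 2 = |θ| ^ 2 := (sq_abs θ).symm
    have h0 := abs_nonneg θ
    have h03 := pow_nonneg h0 3
    have h34 : |θ| ^ 4 ≤ |θ| ^ 3 := pow_le_pow_of_le_one h0 hθ (by norm_num)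
    have h35 : |θ| ^ 5 ≤ |θ| ^ 3 := pow_le_pow_of_le_one h0 hθ (by norm_num)
    have hsq1 : |θ| ^ 2 ≤ 1 := pow_le_one₀ h0 hθ
    have h1 : |e - 1 - -θ ^ 2 / 2| ≤ (-θ ^ 2 / 2) ^ 2 := by
      refine Real.abs_exp_sub_one_sub_id_le ?_
      rw [abs_le]; constructor <;> nlinarith
    have h1' : (-θ ^ 2 / 2) ^ 2 = |θ| ^ 4 / 4 := by rw [hsq]; ring
    have h2 := Real.cos_bound hθ
    have h3 := Real.sin_bound hθ
    have h4 : |Real.cos θ - e| ≤ |θ| ^ 3 := by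
      have := abs_sub (Real.cos θ - (1 - θ ^ 2 / 2)) (e - 1 - -θ ^ 2 / 2)
      rw [show Real.cos θ - (1 - θ ^ 2 / 2) - (e - 1 - -θ ^ 2 / 2) = Real.cos θ - e by ring] at this
      linarith
    have h5 : |Real.sin θ - θ * e| ≤ 2 * |θ| ^ 3 := by
      have h6 : |θ * (e - 1)| ≤ |θ| ^ 3 := by
        rw [abs_mul, pow_succ' |θ| 2, abs_sub_comm, abs_of_nonneg (a := 1 - e) (by linarith)]
        refine mul_le_mul_of_nonneg_left ?_ h0
        have := Real.add_one_le_exp (-θ ^ 2 / 2)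
        have h7 := sq_nonneg |θ|
        linarith
      have h7 : |θ ^ 3 / 6| = |θ| ^ 3 / 6 := by rw [abs_div, abs_pow]; norm_num
      have h8 := abs_sub (Real.sin θ - (θ - θ ^ 3 / 6)) (θ ^ 3 / 6)
      have h9 := abs_sub (Real.sin θ - (θ - θ ^ 3 / 6) - θ ^ 3 / 6) (θ * (e - 1))
      rw [show Real.sin θ - (θ - θ ^ 3 / 6) - θ ^ 3 / 6 - θ * (e - 1) = Real.sin θ - θ * e by
        ring] at h9
      have := pow_nonneg h0 3
      linarith
    have h6 : ‖exp ((θ * y : ℝ) * I) - 1 - (θ * y : ℝ) * I‖ ≤ θ ^ 2 * y ^ 2 := by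
      have : ‖((θ * y : ℝ) : ℂ) * I‖ = |θ| * |y| := by simp
      refine (Complex.norm_exp_sub_one_sub_id_le ?_).trans (le_of_eq ?_)
      · rw [this]; exact mul_le_one₀ hθ (abs_nonneg _) hy
      · rw [this, mul_pow, sq_abs, sq_abs]
    have hsplit : (Real.cos θ + y * Real.sin θ * I : ℂ) - e * exp ((θ * y : ℝ) * I)
        = (Real.cos θ - e : ℝ) + (y * (Real.sin θ - θ * e) : ℝ) * I
          - e * (exp ((θ * y : ℝ) * I) - 1 - (θ * y : ℝ) * I) := by
      push_cast; ring
    rw [hsplit]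
    refine (norm_sub_le _ _).trans ?_
    refine (add_le_add_left (norm_add_le _ _) _).trans ?_
    rw [norm_mul, norm_mul, norm_I, mul_one, Complex.norm_real, Complex.norm_real,
      Complex.norm_real, Real.norm_eq_abs, Real.norm_eq_abs, Real.norm_eq_abs, abs_mul,
      abs_of_pos he0]
    have h7 : |y| * |Real.sin θ - θ * e| ≤ 2 * |θ| ^ 3 :=
      (mul_le_of_le_one_left (abs_nonneg _) hy).trans h5
    have h8 := mul_le_mul he1 h6 (norm_nonneg _) zero_le_one
    have := pow_nonneg h0 3
    linarith
  · have h1 : (1 : ℝ) ≤ |θ| ^ 3 := one_le_pow₀ hθ.le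
    refine (norm_sub_le _ _).trans ?_
    refine (add_le_add_left (norm_add_le _ _) _).trans ?_
    rw [norm_mul, norm_mul, norm_mul, norm_I, hexp, Complex.norm_real, Complex.norm_real,
      Complex.norm_real, Complex.norm_real, Real.norm_eq_abs, Real.norm_eq_abs, Real.norm_eq_abs,
      Real.norm_eq_abs, abs_of_pos he0]
    have h2 := Real.abs_cos_le_one θ
    have h3 := mul_le_one₀ hy (abs_nonneg _) (Real.abs_sin_le_one θ)
    have h4 : 0 ≤ θ ^ 2 * y ^ 2 := by positivity
    linarith

theorem exp_mul_I_of_sign {x θ : ℝ} (hx : x = 1 ∨ x = -1) :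
    exp ((θ * x : ℝ) * I) = Real.cos θ + x * (Real.sin θ * I) := by
  rw [Complex.exp_mul_I]
  rcases hx with rfl | rfl <;> simp

theorem tendsto_zero_of_sq_mul_v_le {p : ℝ} (hp : 0 < p) (hp' : p ≤ 3 / 4) {c : ℕ → ℝ} {K : ℝ}
    (hc : ∀ n, 1 ≤ n → c n ^ 2 * v p n ≤ K) : Tendsto c atTop (𝓝 0) := by
  have hsq : Tendsto (fun n ↦ c n ^ 2) atTop (𝓝 0) := by
    refine squeeze_zero' (.of_forall fun n ↦ sq_nonneg _) ?_
      ((tendsto_v_atTop hp hp').const_div_atTop K)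
    filter_upwards [eventually_ge_atTop 1] with n hn
    exact (le_div_iff₀ (v_pos hp hn)).2 (hc n hn)
  refine (tendsto_zero_iff_abs_tendsto_zero _).2 ?_
  simpa [Function.comp_def, Real.sqrt_sq_eq_abs] using (Real.continuous_sqrt.tendsto 0).comp hsq

namespace IsERW

variable {Ω : Type*} [MeasurableSpace Ω] {μ : Measure Ω} [IsProbabilityMeasure μ]
    {p q : ℝ} {X α : ℕ → Ω → ℝ} {β : ℕ → Ω → ℕ}

theorem norm_charFun_step_le (h : IsERW μ p q X α β) (hp : 0 ≤ p) (hp' : p ≤ 1) {n : ℕ}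
    (hn : 1 ≤ n) (θ : ℝ) :
    ‖∫ ω, exp ((θ * unitPosition X (n + 1) ω : ℝ) * I) ∂μ - Real.exp (-θ ^ 2 / 2) *
        ∫ ω, exp ((θ * (1 + (2 * p - 1) / n) * unitPosition X n ω : ℝ) * I) ∂μ‖
      ≤ θ ^ 2 * ∫ ω, (unitPosition X n ω / n) ^ 2 ∂μ + 4 * |θ| ^ 3 := by
  have hn0 : (0 : ℝ) < n := by exact_mod_cast hn
  have hT := h.measurable_unitPosition n
  have hTi : Integrable (unitPosition X n) μ :=
    .of_bound hT.aestronglyMeasurable (n : ℝ) (h.ae_abs_unitPosition_le n)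
  have hexp (c : ℝ) : Integrable (fun ω ↦ exp ((c * unitPosition X n ω : ℝ) * I)) μ :=
    .of_bound (by fun_prop) 1 (.of_forall fun ω ↦ (norm_exp_ofReal_mul_I _).le)
  have hg : Measurable fun x : Icc 1 n → ℝ ↦ exp ((θ * ∑ i, x i : ℝ) * I) := by fun_prop
  have hgT (ω : Ω) : ∑ i : Icc 1 n, X i ω = unitPosition X n ω :=
    Finset.sum_coe_sort (Icc 1 n) fun i ↦ X i ω
  have key := h.integral_step_smul hp hp' hn hg (by simpa only [hgT] using hexp θ)
  simp only [hgT, real_smul] at key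
  have hTG : Integrable
      (fun ω ↦ (unitPosition X n ω : ℂ) * exp ((θ * unitPosition X n ω : ℝ) * I)) μ :=
    hTi.ofReal.mul_bdd (c := 1) (hexp θ).aestronglyMeasurable
      (.of_forall fun ω ↦ (norm_exp_ofReal_mul_I _).le)
  have hXG : Integrable
      (fun ω ↦ (X (n + 1) ω : ℂ) * exp ((θ * unitPosition X n ω : ℝ) * I)) μ := by
    refine (hexp θ).bdd_mul (c := 1)
      (measurable_ofReal.comp (h.measurable_step (n + 1) (by omega))).aestronglyMeasurable ?_
    filter_upwards [h.ae_norm_step_le (n := n + 1) (by omega)] with ω hω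
    simpa using hω
  -- Because the step is ±1, its exponential is affine in it, so the averaging identity `key`
  -- applies exactly.
  have hae : (fun ω ↦ exp ((θ * unitPosition X (n + 1) ω : ℝ) * I)) =ᵐ[μ] fun ω ↦
      Real.cos θ * exp ((θ * unitPosition X n ω : ℝ) * I)
        + (Real.sin θ * I) * (X (n + 1) ω * exp ((θ * unitPosition X n ω : ℝ) * I)) := by
    filter_upwards [h.ae_step (n := n + 1) (by omega)] with ω hω
    rw [unitPosition_succ, mul_add, ofReal_add, add_mul, exp_add, exp_mul_I_of_sign hω]
    ring
  have hleft : ∫ ω, exp ((θ * unitPosition X (n + 1) ω : ℝ) * I) ∂μ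
      = ∫ ω, (Real.cos θ + ((2 * p - 1) * (unitPosition X n ω / n) : ℝ) * Real.sin θ * I)
        * exp ((θ * unitPosition X n ω : ℝ) * I) ∂μ := by
    rw [integral_congr_ae hae, integral_add ((hexp θ).const_mul _) (hXG.const_mul _),
      integral_const_mul, integral_const_mul, key, ← mul_assoc, ← integral_const_mul,
      ← integral_const_mul, ← integral_add ((hexp θ).const_mul _) (hTG.const_mul _)]
    congr 1 with ω
    push_cast
    ring
  -- Both integrands now share the unimodular factor exp(iθ T_n), which leaves the elementary bound
  -- with y = (2p-1) T_n / n.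
  have hright : Real.exp (-θ ^ 2 / 2) *
      ∫ ω, exp ((θ * (1 + (2 * p - 1) / n) * unitPosition X n ω : ℝ) * I) ∂μ
      = ∫ ω, Real.exp (-θ ^ 2 / 2)
        * exp ((θ * ((2 * p - 1) * (unitPosition X n ω / n)) : ℝ) * I)
        * exp ((θ * unitPosition X n ω : ℝ) * I) ∂μ := by
    rw [← integral_const_mul]
    congr 1 with ω
    rw [mul_assoc _ (exp _) (exp _), ← exp_add]
    congr 2
    push_cast
    ring
  have hi1 : Integrable (fun ω ↦ (Real.cos θ
      + ((2 * p - 1) * (unitPosition X n ω / n) : ℝ) * Real.sin θ * I)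
        * exp ((θ * unitPosition X n ω : ℝ) * I)) μ := by
    refine Integrable.mul_bdd (c := 1) ?_ (hexp θ).aestronglyMeasurable
      (.of_forall fun ω ↦ (norm_exp_ofReal_mul_I _).le)
    exact (integrable_const _).add ((((hTi.div_const _).const_mul _).ofReal.mul_const _).mul_const _)
  have hi2 : Integrable (fun ω ↦ (Real.exp (-θ ^ 2 / 2) : ℂ)
        * exp ((θ * ((2 * p - 1) * (unitPosition X n ω / n)) : ℝ) * I)
        * exp ((θ * unitPosition X n ω : ℝ) * I)) μ := by
    refine Integrable.mul_bdd (c := 1) ?_ (hexp θ).aestronglyMeasurable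
      (.of_forall fun ω ↦ (norm_exp_ofReal_mul_I _).le)
    exact .const_mul (.of_bound (by fun_prop) 1
      (.of_forall fun ω ↦ (norm_exp_ofReal_mul_I _).le)) _
  have hsq : Integrable (fun ω ↦ (unitPosition X n ω / n) ^ 2) μ := by
    simpa only [div_pow] using (h.integrable_unitPosition_sq n).div_const _
  rw [hleft, hright, ← integral_sub hi1 hi2]
  refine (norm_integral_le_of_norm_le
    (g := fun ω ↦ θ ^ 2 * (unitPosition X n ω / n) ^ 2 + 4 * |θ| ^ 3)
    ((hsq.const_mul _).add (integrable_const _)) ?_).trans (le_of_eq ?_)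
  · filter_upwards [h.ae_abs_unitPosition_le n] with ω hω
    have hr : |2 * p - 1| ≤ 1 := abs_le.2 ⟨by linarith, by linarith⟩
    have hy : |unitPosition X n ω / n| ≤ 1 := by
      rw [abs_div, abs_of_pos hn0]; exact div_le_one_of_le₀ hω hn0.le
    rw [← sub_mul, norm_mul, norm_exp_ofReal_mul_I, mul_one]
    refine (norm_cos_add_sin_sub_exp_le ?_).trans ?_
    · rw [abs_mul]; exact mul_le_one₀ hr (abs_nonneg _) hy
    · rw [mul_pow]
      gcongr
      exact mul_le_of_le_one_left (sq_nonneg _) ((sq_le_one_iff_abs_le_one _).2 hr)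
  · rw [integral_add (hsq.const_mul _) (integrable_const _), integral_const_mul]
    simp

/-- The one-step estimate at θ = c a_{n+1} is iterated. Earlier errors are multiplied by a Gaussian
factor at most 1, so they only add up. The terms |c| + c² pay for the first step, which is compared
with the constant 1. -/
theorem norm_charFun_sub_exp_le (h : IsERW μ p q X α β) (hp : 0 < p) (hp' : p ≤ 1) (c : ℝ) {n : ℕ}
    (hn : 1 ≤ n) :
    ‖∫ ω, exp ((c * a p n * unitPosition X n ω : ℝ) * I) ∂μ - Real.exp (-c ^ 2 * v p n / 2)‖
      ≤ |c| + c ^ 2 + ∑ i ∈ range n, (c ^ 2 * (a p (i + 1) ^ 2 *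
        ∫ ω, (unitPosition X i ω / i) ^ 2 ∂μ) + 4 * (|c| ^ 3 * a p (i + 1) ^ 3)) := by
  induction n, hn using Nat.le_induction with
  | base =>
    -- The term i = 0 is not produced by any step of the recursion: its integral vanishes since T_0
    -- = 0, and the rest is nonnegative slack.
    have hsum : 0 ≤ ∑ i ∈ range 1, (c ^ 2 * (a p (i + 1) ^ 2 *
        ∫ ω, (unitPosition X i ω / i) ^ 2 ∂μ) + 4 * (|c| ^ 3 * a p (i + 1) ^ 3)) := by
      simp [unitPosition, a_one hp]
    have hi : Integrable (fun ω ↦ exp ((c * X 1 ω : ℝ) * I)) μ :=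
      .of_bound (by have := h.measurable_step 1 le_rfl; fun_prop) 1
        (.of_forall fun ω ↦ (norm_exp_ofReal_mul_I _).le)
    have h1 : ‖∫ ω, exp ((c * X 1 ω : ℝ) * I) ∂μ - 1‖ ≤ |c| := by
      have : (1 : ℂ) = ∫ _, (1 : ℂ) ∂μ := by simp
      rw [this, ← integral_sub hi (integrable_const _)]
      refine (norm_integral_le_of_norm_le_const (C := |c|) ?_).trans (by simp)
      filter_upwards [h.ae_norm_step_le le_rfl] with ω hω
      rw [mul_comm _ I]
      refine Real.norm_exp_I_mul_ofReal_sub_one_le.trans ?_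
      rw [norm_mul]
      exact mul_le_of_le_one_right (abs_nonneg _) hω
    have h2 : ‖(1 : ℂ) - Real.exp (-c ^ 2 / 2)‖ ≤ c ^ 2 := by
      rw [← ofReal_one, ← ofReal_sub, Complex.norm_real, Real.norm_eq_abs, abs_of_nonneg]
      · nlinarith [Real.add_one_le_exp (-c ^ 2 / 2), sq_nonneg c]
      · exact sub_nonneg.2 (Real.exp_le_one_iff.2 (by nlinarith [sq_nonneg c]))
    have h3 := norm_add_le (∫ ω, exp ((c * X 1 ω : ℝ) * I) ∂μ - 1) (1 - Real.exp (-c ^ 2 / 2))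
    rw [sub_add_sub_cancel] at h3
    have hv : v p 1 = 1 := by simp [v, a_one hp]
    have hT (ω : Ω) : unitPosition X 1 ω = X 1 ω := by simp [unitPosition]
    simp only [hv, hT, a_one hp, mul_one]
    linarith
  | succ n hn ih =>
    have hstep := h.norm_charFun_step_le hp.le hp' hn (c * a p (n + 1))
    rw [mul_assoc c, ← a_eq_succ_mul hp hn] at hstep
    set A := ∫ ω, exp ((c * a p (n + 1) * unitPosition X (n + 1) ω : ℝ) * I) ∂μ
    set B := ∫ ω, exp ((c * a p n * unitPosition X n ω : ℝ) * I) ∂μ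
    have he : Real.exp (-c ^ 2 * v p (n + 1) / 2)
        = Real.exp (-(c * a p (n + 1)) ^ 2 / 2) * Real.exp (-c ^ 2 * v p n / 2) := by
      rw [← Real.exp_add, v_succ]; ring_nf
    have hle : Real.exp (-(c * a p (n + 1)) ^ 2 / 2) ≤ 1 :=
      Real.exp_le_one_iff.2 (by nlinarith [sq_nonneg (c * a p (n + 1))])
    set e := Real.exp (-(c * a p (n + 1)) ^ 2 / 2)
    have h1 : ‖(e : ℂ) * (B - Real.exp (-c ^ 2 * v p n / 2))‖
        ≤ ‖B - Real.exp (-c ^ 2 * v p n / 2)‖ := by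
      rw [norm_mul, Complex.norm_real, Real.norm_eq_abs, abs_of_pos (Real.exp_pos _)]
      exact mul_le_of_le_one_left (norm_nonneg _) hle
    have h2 := norm_add_le (A - e * B) (e * (B - Real.exp (-c ^ 2 * v p n / 2)))
    rw [show A - e * B + e * (B - Real.exp (-c ^ 2 * v p n / 2))
      = A - Real.exp (-c ^ 2 * v p (n + 1) / 2) by rw [he]; push_cast; ring] at h2
    rw [abs_mul, abs_of_pos (a_pos hp (n := n + 1) (by omega)), mul_pow, mul_pow] at hstep
    rw [Finset.sum_range_succ]
    linarith

theorem tendsto_charFun_sub_exp (h : IsERW μ p q X α β) (hp : 0 < p) (hp' : p ≤ 3 / 4) {c : ℕ → ℝ}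
    {K : ℝ} (hc : ∀ n, 1 ≤ n → c n ^ 2 * v p n ≤ K) :
    Tendsto (fun n ↦ ∫ ω, exp ((c n * a p n * unitPosition X n ω : ℝ) * I) ∂μ
      - Real.exp (-c n ^ 2 * v p n / 2)) atTop (𝓝 0) := by
  have hK : 0 ≤ K := (mul_nonneg (sq_nonneg _) (v_nonneg p 1)).trans (hc 1 le_rfl)
  have hc0 := tendsto_zero_of_sq_mul_v_le hp hp' hc
  have habs : Tendsto (fun n ↦ |c n|) atTop (𝓝 0) := by simpa using hc0.abs
  have hsq : Tendsto (fun n ↦ c n ^ 2) atTop (𝓝 0) := by simpa using hc0.pow 2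
  have h1 := (tendsto_weighted_average_zero hp hp'
    (h.tendsto_integral_unitPosition_div_sq hp.le hp')).const_mul K
  have h2 := (tendsto_weighted_average_zero hp hp' (tendsto_a_div_sqrt_v hp)).const_mul (4 * √K * K)
  have hlim := (habs.add hsq).add (h1.add h2)
  simp only [mul_zero, add_zero] at hlim
  refine squeeze_zero_norm' ?_ hlim
  filter_upwards [eventually_ge_atTop 1] with n hn
  refine (h.norm_charFun_sub_exp_le hp (by linarith) (c n) hn).trans ?_
  have hv := v_pos hp hn
  have hcv : c n ^ 2 ≤ K / v p n := (le_div_iff₀ hv).2 (hc n hn)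
  have hmono {i : ℕ} (hi : i ∈ range n) : v p (i + 1) ≤ v p n :=
    Finset.sum_le_sum_of_subset_of_nonneg
      (Finset.Icc_subset_Icc_right (Finset.mem_range.1 hi)) fun _ _ _ ↦ sq_nonneg _
  -- Of the three factors |c_n| in the cubic error, two are bounded through v_n and one through the
  -- smaller v_{i+1}; this leaves an average of a_{i+1}/√v_{i+1} with weights a_{i+1}².
  have hcabs {i : ℕ} (hi : i ∈ range n) : |c n| ≤ √K / √(v p (i + 1)) := by
    rw [← Real.sqrt_div hK]
    refine Real.abs_le_sqrt (hcv.trans ?_)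
    exact div_le_div_of_nonneg_left hK (v_pos hp (by omega)) (hmono hi)
  refine add_le_add_right ?_ _
  rw [Finset.sum_add_distrib]
  refine add_le_add ?_ ?_
  · rw [← Finset.mul_sum, mul_div_assoc', mul_comm K, mul_div_assoc, mul_comm]
    exact mul_le_mul_of_nonneg_left hcv (Finset.sum_nonneg fun i _ ↦
      mul_nonneg (sq_nonneg _) (integral_nonneg fun _ ↦ sq_nonneg _))
  · have hterm : ∑ i ∈ range n, 4 * (|c n| ^ 3 * a p (i + 1) ^ 3)
        ≤ ∑ i ∈ range n, 4 * √K * (K / v p n) * (a p (i + 1) ^ 2 *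
          (a p (i + 1) / √(v p (i + 1)))) := by
      refine Finset.sum_le_sum fun i hi ↦ ?_
      have ha := a_pos hp (n := i + 1) (by omega)
      have : |c n| ^ 3 ≤ (K / v p n) * (√K / √(v p (i + 1))) := by
        rw [pow_succ, sq_abs]
        exact mul_le_mul hcv (hcabs hi) (abs_nonneg _) (div_nonneg hK hv.le)
      calc 4 * (|c n| ^ 3 * a p (i + 1) ^ 3)
          ≤ 4 * ((K / v p n) * (√K / √(v p (i + 1))) * a p (i + 1) ^ 3) := by gcongr
        _ = _ := by ring
    refine hterm.trans (le_of_eq ?_)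
    rw [← Finset.mul_sum]
    ring

end IsERW

end ElephantRW

/-! ### Sums of i.i.d. variables with independent weights. -/

namespace ElephantRW

open Finset Topology Complex

variable {Ω : Type*} [MeasurableSpace Ω] {μ : Measure Ω}

theorem norm_prod_sub_prod_le_sum {ι : Type*} (s : Finset ι) (f g : ι → ℂ)
    (hf : ∀ i ∈ s, ‖f i‖ ≤ 1) (hg : ∀ i ∈ s, ‖g i‖ ≤ 1) :
    ‖∏ i ∈ s, f i - ∏ i ∈ s, g i‖ ≤ ∑ i ∈ s, ‖f i - g i‖ := by
  classical
  induction s using Finset.induction_on with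
  | empty => simp
  | insert j s hj ih =>
    rw [Finset.prod_insert hj, Finset.prod_insert hj, Finset.sum_insert hj]
    have hf' : ∀ i ∈ s, ‖f i‖ ≤ 1 := fun i hi ↦ hf i (Finset.mem_insert_of_mem hi)
    have hg' : ∀ i ∈ s, ‖g i‖ ≤ 1 := fun i hi ↦ hg i (Finset.mem_insert_of_mem hi)
    have h1 : ‖∏ i ∈ s, f i‖ ≤ 1 := by
      rw [norm_prod]; exact Finset.prod_le_one (fun _ _ ↦ norm_nonneg _) hf'
    rw [show f j * ∏ i ∈ s, f i - g j * ∏ i ∈ s, g i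
      = (f j - g j) * ∏ i ∈ s, f i + g j * (∏ i ∈ s, f i - ∏ i ∈ s, g i) by ring]
    refine (norm_add_le _ _).trans ?_
    rw [norm_mul, norm_mul]
    exact add_le_add (mul_le_of_le_one_right (norm_nonneg _) h1)
      ((mul_le_of_le_one_left (norm_nonneg _) (hg j (Finset.mem_insert_self j s))).trans
        (ih hf' hg'))

/-- Changing the sign of the frequency conjugates both terms, as the Gaussian factor is real and
even in d. -/
theorem norm_charFun_sign_sub {Y : Ω → ℝ} (s : ℝ) {d x : ℝ} (hx : x = 1 ∨ x = -1) :
    ‖charFun (μ.map Y) (d * x) - exp ((d * x : ℝ) * I) * Real.exp (-s * d ^ 2 / 2)‖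
      = ‖charFun (μ.map Y) d - exp ((d : ℝ) * I) * Real.exp (-s * d ^ 2 / 2)‖ := by
  rcases hx with rfl | rfl
  · simp
  · rw [← norm_conj (charFun (μ.map Y) d - _), map_sub, map_mul, conj_ofReal, ← exp_conj,
      mul_neg, mul_one, charFun_neg]
    simp

variable [IsProbabilityMeasure μ]

/-- The characteristic function of a weighted sum of i.i.d. variables with independent weights. -/
theorem integral_exp_sum_mul {U V : ℕ → Ω → ℝ} (hU : ∀ i, Measurable (U i))
    (hV : ∀ i, Measurable (V i)) (hUV : IndepFun (fun ω i ↦ U i ω) (fun ω i ↦ V i ω) μ)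
    (hind : iIndepFun V μ) (hid : ∀ i, IdentDistrib (V i) (V 0) μ μ) (d : ℝ) (n : ℕ) :
    ∫ ω, exp ((d * ∑ i ∈ range n, U i ω * V i ω : ℝ) * I) ∂μ
      = ∫ ω, ∏ i ∈ range n, charFun (μ.map (V 0)) (d * U i ω) ∂μ := by
  have hU' : Measurable fun ω i ↦ U i ω := measurable_pi_lambda _ hU
  have hV' : Measurable fun ω i ↦ V i ω := measurable_pi_lambda _ hV
  have : IsProbabilityMeasure (μ.map fun ω i ↦ U i ω) :=
    Measure.isProbabilityMeasure_map hU'.aemeasurable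
  have : IsProbabilityMeasure (μ.map fun ω i ↦ V i ω) :=
    Measure.isProbabilityMeasure_map hV'.aemeasurable
  have hF : Measurable fun z : (ℕ → ℝ) × (ℕ → ℝ) ↦
      exp ((d * ∑ i ∈ range n, z.1 i * z.2 i : ℝ) * I) := by fun_prop
  have h1 : ∫ ω, exp ((d * ∑ i ∈ range n, U i ω * V i ω : ℝ) * I) ∂μ
      = ∫ z, exp ((d * ∑ i ∈ range n, z.1 i * z.2 i : ℝ) * I)
        ∂μ.map fun ω ↦ ((fun i ↦ U i ω), fun i ↦ V i ω) :=
    (integral_map (hU'.prodMk hV').aemeasurable hF.aestronglyMeasurable).symm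
  rw [h1, (indepFun_iff_map_prod_eq_prod_map_map hU'.aemeasurable hV'.aemeasurable).1 hUV,
    integral_prod _ (.of_bound hF.aestronglyMeasurable 1
      (.of_forall fun z ↦ (norm_exp_ofReal_mul_I _).le)),
    integral_map hU'.aemeasurable
      hF.stronglyMeasurable.integral_prod_right.aestronglyMeasurable]
  congr 1 with ω
  rw [integral_map hV'.aemeasurable (by fun_prop)]
  have hind' : iIndepFun (fun i ω' ↦ (d * U i ω) * V i ω') μ :=
    hind.comp (fun i y ↦ (d * U i ω) * y) fun i ↦ measurable_const_mul _
  have h2 := (hind'.restrict (range n)).charFun_map_fun_finsetSum_eq_prod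
    (fun i _ ↦ ((hV i).const_mul _).aemeasurable)
  -- The frequencies d U_i vary with i, so they are absorbed into the variables and the
  -- characteristic function is taken at 1.
  have h3 := congrFun h2 1
  rw [Finset.prod_apply, charFun_apply_real, integral_map (by fun_prop) (by fun_prop)] at h3
  simp only [ofReal_one, one_mul] at h3
  have h4 (i : ℕ) : charFun (μ.map fun ω' ↦ (d * U i ω) * V i ω') 1
      = charFun (μ.map (V 0)) (d * U i ω) := by
    rw [charFun_map_mul_comp (hV i).aemeasurable, mul_one, (hid i).map_eq]
  simp only [h4] at h3
  rw [← h3]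
  congr 1 with ω'
  simp only [Finset.mul_sum, mul_assoc]

/-- After centring at the mean 1, both functions have the second-order expansion 1 - Var(Y) d²/2.
Undoing the centring multiplies by exp(id), which has modulus 1. -/
theorem charFun_sub_exp_isLittleO {Y : Ω → ℝ} (hY : Measurable Y) (hint : Integrable Y μ)
    (hmean : ∫ ω, Y ω ∂μ = 1) (hsq : Integrable (fun ω ↦ Y ω ^ 2) μ) :
    (fun d : ℝ ↦ charFun (μ.map Y) d - exp ((d : ℝ) * I) * Real.exp (-Var[Y; μ] * d ^ 2 / 2))
      =o[𝓝 0] fun d ↦ d ^ 2 := by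
  set W : Ω → ℝ := fun ω ↦ Y ω - 1
  have hW : Measurable W := hY.sub_const 1
  have hY2 : MemLp Y 2 μ := (memLp_two_iff_integrable_sq hY.aestronglyMeasurable).2 hsq
  have hW2 : MemLp W 2 μ := hY2.sub (memLp_const 1)
  have : IsProbabilityMeasure (μ.map W) := Measure.isProbabilityMeasure_map hW.aemeasurable
  have hWid : MemLp id 2 (μ.map W) :=
    (memLp_map_measure_iff aestronglyMeasurable_id hW.aemeasurable).2 hW2
  have hW0 : ∫ ω, W ω ∂μ = 0 := by
    rw [integral_sub hint (integrable_const _), hmean]; simp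
  have hWvar : ∫ ω, (W ^ 2) ω ∂μ = Var[Y; μ] := by
    rw [variance_eq_integral hY.aemeasurable, hmean]; rfl
  have h1 : (fun d : ℝ ↦ charFun (μ.map W) d - (1 - Var[Y; μ] * d ^ 2 / 2)) =o[𝓝 0]
      fun d ↦ d ^ 2 := by
    have := taylor_isLittleO_univ (f := charFun (μ.map W)) (x₀ := 0) (n := 2)
      (contDiff_charFun (by exact_mod_cast hWid))
    simp_rw [taylorWithinEval_charFun_two_zero hW.aemeasurable hWid, hW0, hWvar] at this
    simpa using this
  have h2 : (fun d : ℝ ↦ Real.exp (-Var[Y; μ] * d ^ 2 / 2) - (1 - Var[Y; μ] * d ^ 2 / 2)) =o[𝓝 0]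
      fun d ↦ d ^ 2 := by
    have hd : Tendsto (fun d : ℝ ↦ -Var[Y; μ] * d ^ 2 / 2) (𝓝 0) (𝓝 0) := by
      have : Continuous fun d : ℝ ↦ -Var[Y; μ] * d ^ 2 / 2 := by fun_prop
      simpa using this.tendsto 0
    have h3 := ((Real.hasDerivAt_exp 0).isLittleO).comp_tendsto hd
    simp only [Function.comp_def, Real.exp_zero, sub_zero, smul_eq_mul, mul_one] at h3
    refine (h3.congr_left fun d ↦ by ring).trans_isBigO ?_
    refine .of_bound (‖-Var[Y; μ] / 2‖) (.of_forall fun d ↦ ?_)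
    rw [← norm_mul]
    exact le_of_eq (by ring_nf)
  have h3 : (fun d : ℝ ↦ charFun (μ.map W) d - Real.exp (-Var[Y; μ] * d ^ 2 / 2)) =o[𝓝 0]
      fun d ↦ d ^ 2 := by
    have h2' : (fun d : ℝ ↦ ((Real.exp (-Var[Y; μ] * d ^ 2 / 2) - (1 - Var[Y; μ] * d ^ 2 / 2) : ℝ)
        : ℂ)) =o[𝓝 0] fun d ↦ d ^ 2 :=
      Asymptotics.IsLittleO.of_norm_left (by simpa only [Complex.norm_real] using h2.norm_left)
    refine (h1.sub h2').congr_left fun d ↦ ?_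
    push_cast; ring
  refine Asymptotics.IsLittleO.of_norm_left (h3.norm_left.congr_left fun d ↦ ?_)
  have h4 : charFun (μ.map Y) d = exp ((d : ℝ) * I) * charFun (μ.map W) d := by
    rw [charFun_apply_real, charFun_apply_real, integral_map hY.aemeasurable (by fun_prop),
      integral_map hW.aemeasurable (by fun_prop), ← integral_const_mul]
    congr 1 with ω
    rw [← exp_add]
    congr 1
    simp only [W]
    push_cast; ring
  rw [h4, ← mul_sub, norm_mul, norm_exp_ofReal_mul_I, one_mul]

end ElephantRW

/-! ### From unit steps to random step sizes. -/

namespace ElephantRW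

open Finset Topology Complex

variable {Ω : Type*} [MeasurableSpace Ω] {μ : Measure Ω}
    {p q : ℝ} {X α : ℕ → Ω → ℝ} {β : ℕ → Ω → ℕ} {Z : ℕ → Ω → ℝ}

theorem unitPosition_eq_sum_range {Ω : Type*} (X : ℕ → Ω → ℝ) (n : ℕ) (ω : Ω) :
    unitPosition X n ω = ∑ i ∈ range n, X (i + 1) ω := by
  rw [unitPosition, Finset.range_eq_Ico, Finset.sum_Ico_add' (fun i ↦ X i ω) 0 n 1]
  rfl

theorem IsERW.position_ae_eq (h : IsERW μ p q X α β) (Z : ℕ → Ω → ℝ) (n : ℕ) :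
    position X α β Z n =ᵐ[μ] fun ω ↦ ∑ i ∈ range n, X (i + 1) ω * Z (i + 1) ω := by
  have hall : ∀ᵐ ω ∂μ, ∀ i : ℕ, displacement X α β Z (i + 1) ω = X (i + 1) ω * Z (i + 1) ω := by
    refine ae_all_iff.2 fun i ↦ ?_
    rcases Nat.eq_zero_or_pos i with rfl | hi
    · simp [displacement]
    · filter_upwards [h.step_eq i hi] with ω hω
      rw [displacement, if_neg (by omega), hω]
  filter_upwards [hall] with ω hω
  rw [position, ← Finset.sum_congr rfl fun i _ ↦ hω i, Finset.range_eq_Ico,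
    Finset.sum_Ico_add' (fun i ↦ displacement X α β Z i ω) 0 n 1]
  rfl

theorem IsERW.aemeasurable_position (h : IsERW μ p q X α β) (hZ : IsStepSize μ Z) (n : ℕ) :
    AEMeasurable (position X α β Z n) μ :=
  (Finset.measurable_sum _ fun i _ ↦ (h.measurable_step (i + 1) (by omega)).mul
    (hZ.measurable (i + 1) (by omega))).aemeasurable.congr (h.position_ae_eq Z n).symm

variable [IsProbabilityMeasure μ]

/-- Replacing the random step sizes by their mean costs a deterministic Gaussian factor. -/
theorem IsERW.norm_charFun_position_sub_le (h : IsERW μ p q X α β) (hZ : IsStepSize μ Z)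
    (hXZ : IndepFun (fun ω (n : ℕ) ↦ X (n + 1) ω) (fun ω (n : ℕ) ↦ Z (n + 1) ω) μ)
    {s : ℝ} (hs : 0 ≤ s) (d : ℝ) (n : ℕ) :
    ‖∫ ω, exp ((d * position X α β Z n ω : ℝ) * I) ∂μ - Real.exp (-s * d ^ 2 / 2) ^ n *
        ∫ ω, exp ((d * unitPosition X n ω : ℝ) * I) ∂μ‖
      ≤ n * ‖charFun (μ.map (Z 1)) d - exp ((d : ℝ) * I) * Real.exp (-s * d ^ 2 / 2)‖ := by
  have hX (i : ℕ) : Measurable (X (i + 1)) := h.measurable_step (i + 1) (by omega)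
  have : IsProbabilityMeasure (μ.map (Z 1)) :=
    Measure.isProbabilityMeasure_map (hZ.measurable 1 le_rfl).aemeasurable
  have h1 : ∫ ω, exp ((d * position X α β Z n ω : ℝ) * I) ∂μ
      = ∫ ω, exp ((d * ∑ i ∈ range n, X (i + 1) ω * Z (i + 1) ω : ℝ) * I) ∂μ := by
    refine integral_congr_ae ?_
    filter_upwards [h.position_ae_eq Z n] with ω hω
    rw [hω]
  have h2 : Real.exp (-s * d ^ 2 / 2) ^ n * ∫ ω, exp ((d * unitPosition X n ω : ℝ) * I) ∂μ
      = ∫ ω, ∏ i ∈ range n, exp ((d * X (i + 1) ω : ℝ) * I) * Real.exp (-s * d ^ 2 / 2) ∂μ := by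
    rw [← integral_const_mul]
    congr 1 with ω
    rw [Finset.prod_mul_distrib, Finset.prod_const, Finset.card_range, ← exp_sum,
      unitPosition_eq_sum_range, mul_comm]
    congr 2
    push_cast
    rw [Finset.mul_sum, Finset.sum_mul]
  have hcf : Measurable (charFun (μ.map (Z 1))) := by fun_prop
  have hb1 (x : ℝ) : ‖charFun (μ.map (Z 1)) x‖ ≤ 1 := norm_charFun_le_one x
  have hb2 (x : ℝ) : ‖exp ((x : ℝ) * I) * Real.exp (-s * d ^ 2 / 2)‖ ≤ 1 := by
    rw [norm_mul, norm_exp_ofReal_mul_I, one_mul, Complex.norm_real, Real.norm_eq_abs, Real.abs_exp]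
    exact Real.exp_le_one_iff.2 (by nlinarith [mul_nonneg hs (sq_nonneg d)])
  have hi1 : Integrable (fun ω ↦ ∏ i ∈ range n, charFun (μ.map (Z 1)) (d * X (i + 1) ω)) μ := by
    refine .of_bound (Finset.measurable_prod _ fun i _ ↦
      hcf.comp ((hX i).const_mul d)).aestronglyMeasurable 1 (.of_forall fun ω ↦ ?_)
    rw [norm_prod]
    exact Finset.prod_le_one (fun _ _ ↦ norm_nonneg _) fun i _ ↦ hb1 _
  have hi2 : Integrable (fun ω ↦ ∏ i ∈ range n,
      exp ((d * X (i + 1) ω : ℝ) * I) * Real.exp (-s * d ^ 2 / 2)) μ := by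
    refine .of_bound (Finset.measurable_prod _ fun i _ ↦ ?_).aestronglyMeasurable 1
      (.of_forall fun ω ↦ ?_)
    · have := hX i
      fun_prop
    · rw [norm_prod]
      exact Finset.prod_le_one (fun _ _ ↦ norm_nonneg _) fun i _ ↦ hb2 _
  rw [h1, h2, integral_exp_sum_mul (U := fun i ↦ X (i + 1)) (V := fun i ↦ Z (i + 1)) hX
    (fun i ↦ hZ.measurable (i + 1) (by omega)) hXZ hZ.indep
    (fun i ↦ hZ.identDistrib (i + 1) (by omega)), ← integral_sub hi1 hi2]
  refine (norm_integral_le_of_norm_le_const (C := n * ‖charFun (μ.map (Z 1)) d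
    - exp ((d : ℝ) * I) * Real.exp (-s * d ^ 2 / 2)‖) ?_).trans (by simp)
  have hall : ∀ᵐ ω ∂μ, ∀ i : ℕ, X (i + 1) ω = 1 ∨ X (i + 1) ω = -1 :=
    ae_all_iff.2 fun i ↦ h.ae_step (by omega)
  filter_upwards [hall] with ω hω
  refine (norm_prod_sub_prod_le_sum _ _ _ (fun _ _ ↦ hb1 _) fun _ _ ↦ hb2 _).trans (le_of_eq ?_)
  -- All n factors contribute the same error whatever the signs, so the bound is deterministic.
  rw [Finset.sum_congr rfl fun i _ ↦ norm_charFun_sign_sub s (hω i)]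
  simp

/-- The variance used to normalize the walk. -/
noncomputable def normVariance (p s : ℝ) (n : ℕ) : ℝ := v p n + n * a p n ^ 2 * s

theorem v_le_normVariance (p : ℝ) {s : ℝ} (hs : 0 ≤ s) (n : ℕ) : v p n ≤ normVariance p s n :=
  le_add_of_nonneg_right (by positivity)

theorem IsERW.tendsto_charFun_position (h : IsERW μ p q X α β) (hp : 0 < p) (hp' : p ≤ 3 / 4)
    (hZ : IsStepSize μ Z)
    (hXZ : IndepFun (fun ω (n : ℕ) ↦ X (n + 1) ω) (fun ω (n : ℕ) ↦ Z (n + 1) ω) μ)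
    (hZ2 : Integrable (fun ω ↦ Z 1 ω ^ 2) μ) (t : ℝ) {c : ℕ → ℝ}
    (hc : ∀ n, 1 ≤ n → c n ^ 2 * normVariance p Var[Z 1; μ] n = t ^ 2) :
    Tendsto (fun n ↦ ∫ ω, exp ((c n * a p n * position X α β Z n ω : ℝ) * I) ∂μ) atTop
      (𝓝 (Real.exp (-t ^ 2 / 2) : ℝ)) := by
  have hs : 0 ≤ Var[Z 1; μ] := variance_nonneg _ _
  set s := Var[Z 1; μ]
  have hcv (n : ℕ) (hn : 1 ≤ n) : c n ^ 2 * v p n ≤ t ^ 2 :=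
    (mul_le_mul_of_nonneg_left (v_le_normVariance p hs n) (sq_nonneg _)).trans (hc n hn).le
  -- This bound turns the n-fold error o(d²) at d = c_n a_n into o(1).
  have hd (n : ℕ) : n * (c n * a p n) ^ 2 ≤ 3 * t ^ 2 := by
    rcases Nat.eq_zero_or_pos n with rfl | hn
    · simp; positivity
    · have h1 := mul_le_mul_of_nonneg_left (natCast_mul_a_sq_le hp hn) (sq_nonneg (c n))
      have h2 := hcv n hn
      rw [mul_pow]
      linarith
  have hd0 : Tendsto (fun n ↦ c n * a p n) atTop (𝓝 0) := by
    have h1 : Tendsto (fun n : ℕ ↦ √(3 * t ^ 2 / n)) atTop (𝓝 0) := by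
      rw [← Real.sqrt_zero]
      exact (Real.continuous_sqrt.tendsto 0).comp (tendsto_const_div_atTop_nhds_zero_nat _)
    refine squeeze_zero_norm' ?_ h1
    filter_upwards [eventually_ge_atTop 1] with n hn
    have hn0 : (0 : ℝ) < n := by exact_mod_cast hn
    exact Real.abs_le_sqrt ((le_div_iff₀ hn0).2 (by linarith [hd n]))
  set η : ℝ → ℂ := fun d ↦ charFun (μ.map (Z 1)) d - exp ((d : ℝ) * I) * Real.exp (-s * d ^ 2 / 2)
  have hη : Tendsto (fun n : ℕ ↦ n * ‖η (c n * a p n)‖) atTop (𝓝 0) := by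
    have h1 := ((charFun_sub_exp_isLittleO (hZ.measurable 1 le_rfl) hZ.integrable hZ.mean_one
      hZ2).comp_tendsto hd0).norm_left
    have h2 := (Asymptotics.isBigO_refl (fun n : ℕ ↦ (n : ℝ)) atTop).mul_isLittleO h1
    refine (Asymptotics.isLittleO_one_iff ℝ).1 (h2.trans_isBigO ?_)
    refine .of_bound (3 * t ^ 2) (.of_forall fun n ↦ ?_)
    rw [Function.comp_apply, Real.norm_eq_abs, abs_of_nonneg (by positivity)]
    simpa using hd n
  have hE (n : ℕ) : ‖((Real.exp (-s * (c n * a p n) ^ 2 / 2) : ℂ)) ^ n‖ ≤ 1 := by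
    rw [norm_pow, Complex.norm_real, Real.norm_eq_abs, Real.abs_exp]
    refine pow_le_one₀ (Real.exp_pos _).le (Real.exp_le_one_iff.2 ?_)
    nlinarith [mul_nonneg hs (sq_nonneg (c n * a p n))]
  have hwalk := (h.tendsto_charFun_sub_exp hp hp' hcv).norm
  rw [norm_zero] at hwalk
  rw [tendsto_iff_norm_sub_tendsto_zero]
  have hlim := hη.add hwalk
  rw [add_zero] at hlim
  refine squeeze_zero' (.of_forall fun n ↦ norm_nonneg _) ?_ hlim
  filter_upwards [eventually_ge_atTop 1] with n hn
  -- The step sizes account for the part n a_n² σ² of the normalizing variance, the unit walk for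
  -- the part v_n.
  have hgauss : (Real.exp (-t ^ 2 / 2) : ℂ)
      = Real.exp (-s * (c n * a p n) ^ 2 / 2) ^ n * Real.exp (-c n ^ 2 * v p n / 2) := by
    norm_cast
    rw [← Real.exp_nat_mul, ← Real.exp_add, neg_eq_neg_one_mul (t ^ 2), ← hc n hn, normVariance]
    congr 1
    ring
  have h1 := h.norm_charFun_position_sub_le hZ hXZ hs (c n * a p n) n
  set A := ∫ ω, exp ((c n * a p n * position X α β Z n ω : ℝ) * I) ∂μ
  set B := ∫ ω, exp ((c n * a p n * unitPosition X n ω : ℝ) * I) ∂μ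
  set E := (Real.exp (-s * (c n * a p n) ^ 2 / 2) : ℂ) ^ n
  rw [hgauss, show A - E * Real.exp (-c n ^ 2 * v p n / 2)
    = (A - E * B) + E * (B - Real.exp (-c n ^ 2 * v p n / 2)) by ring]
  refine (norm_add_le _ _).trans (add_le_add h1 ?_)
  rw [norm_mul]
  exact mul_le_of_le_one_left (norm_nonneg _) (hE n)

end ElephantRW

/-! ### Conclusion by Lévy's continuity theorem. -/

theorem theorem2 {Ω : Type*} [MeasurableSpace Ω] (μ : Measure Ω) [IsProbabilityMeasure μ]
    (p q : ℝ) (hp : 0 < p) (hp' : p ≤ 3 / 4) (hq : 0 < q) (hq' : q ≤ 1)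
    (X α : ℕ → Ω → ℝ) (β : ℕ → Ω → ℕ) (Z : ℕ → Ω → ℝ)
    (hX : ElephantRW.IsERW μ p q X α β)
    (hZ : ElephantRW.IsStepSize μ Z)
    (hXZ : IndepFun (fun ω (n : ℕ) ↦ X (n + 1) ω) (fun ω (n : ℕ) ↦ Z (n + 1) ω) μ)
    (hZ2 : Integrable (fun ω ↦ Z 1 ω ^ 2) μ) :
    TendstoInDistribution
      (fun (n : ℕ) ω ↦
        (ElephantRW.a p n * ElephantRW.position X α β Z n ω - (2 * q - 1)) /
          √(ElephantRW.v p n + n * ElephantRW.a p n ^ 2 * Var[Z 1; μ]))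
      atTop (id : ℝ → ℝ) (fun _ ↦ μ) (gaussianReal 0 1) := by
  have hmeas (n : ℕ) : AEMeasurable (fun ω ↦
      (ElephantRW.a p n * ElephantRW.position X α β Z n ω - (2 * q - 1)) /
        √(ElephantRW.v p n + n * ElephantRW.a p n ^ 2 * Var[Z 1; μ])) μ :=
    (((hX.aemeasurable_position hZ n).const_mul _).sub_const _).div_const _
  have hs : 0 ≤ Var[Z 1; μ] := variance_nonneg _ _
  refine ⟨hmeas, aemeasurable_id, ProbabilityMeasure.tendsto_iff_tendsto_charFun.2 fun t ↦ ?_⟩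
  set c : ℕ → ℝ := fun n ↦ t / √(ElephantRW.normVariance p Var[Z 1; μ] n)
  have hc (n : ℕ) (hn : 1 ≤ n) : c n ^ 2 * ElephantRW.normVariance p Var[Z 1; μ] n = t ^ 2 := by
    have hpos : 0 < ElephantRW.normVariance p Var[Z 1; μ] n :=
      (ElephantRW.v_pos hp hn).trans_le (ElephantRW.v_le_normVariance p hs n)
    simp only [c]
    rw [div_pow, Real.sq_sqrt hpos.le, div_mul_cancel₀ _ hpos.ne']
  have hc0 : Tendsto c atTop (nhds 0) :=
    ElephantRW.tendsto_zero_of_sq_mul_v_le hp hp' (K := t ^ 2) fun n hn ↦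
      (mul_le_mul_of_nonneg_left (ElephantRW.v_le_normVariance p hs n) (sq_nonneg _)).trans
        (hc n hn).le
  -- The centring 2q - 1 is asymptotically negligible: it only contributes a phase that tends to 1,
  -- since the normalization diverges.
  have hcenter : Tendsto (fun n ↦ Complex.exp ((c n * -(2 * q - 1) : ℝ) * Complex.I)) atTop
      (nhds 1) := by
    have hcont : Continuous fun x : ℝ ↦ Complex.exp ((x * -(2 * q - 1) : ℝ) * Complex.I) := by
      fun_prop
    simpa [Function.comp_def] using (hcont.tendsto 0).comp hc0
  have hlim := hcenter.mul (hX.tendsto_charFun_position hp hp' hZ hXZ hZ2 t hc)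
  rw [one_mul] at hlim
  simp only [ProbabilityMeasure.coe_mk, Measure.map_id, charFun_gaussianReal]
  convert! hlim using 2 with n
  · rw [charFun_apply_real, integral_map (hmeas n) (by fun_prop), ← integral_const_mul]
    congr 1 with ω
    rw [← Complex.exp_add]
    congr 1
    simp only [c, ElephantRW.normVariance]
    push_cast
    ring
  · simp [neg_div]
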